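/- For $\varphi\in(0,\pi/2)$, $\rho\in\mathbb R$, let $C(\varphi,\rho)\subset\mathbb R^2$ be the closed double cone $\{(x,y): |y|\ge \tan(\varphi)\,|x|\}$ rotated counter-clockwise about the origin by the angle $\rho$. For $P\in\mathbb R^2$ and $h>0$ put $C_P(\varphi,\rho)=P+C(\varphi,\rho)$ and $C_P(\varphi,\rho,h)=C_P(\varphi,\rho)\cap \overline{B}(P,h)$, where $\overline B(P,h)$ is the closed disc. Let $\mathcal H^1$ be the one-dimensional Hausdorff measure, normalized so that the measure of a segment is its length. **Theorem.** Let $\gamma:[0,1]\to\mathbb R^2$ be continuous; write $\gamma$ also for its image. Let $k\in\mathbb N$, $\varphi\in(0,\pi/2)$, $\rho\in\mathbb R$, and suppose that every line contained in $C_P(\varphi,\rho)$ for some $P\in\mathbb R^2$ meets $\gamma$ in at most $k$ points. Then $\gamma$ is $\sigma$-finite with respect to $\mathcal H^1$. More precisely, call $(\theta,\sigma,h)$ admissible if $0<\theta<\pi/2$, $h>0$ and $C(\theta,\sigma)\subset C(\varphi,\rho)$. There is an enumeration $(\theta_n,\sigma_n,h_n)_{n\in\mathbb N}$ (repetitions allowed)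 of all admissible triples of rational numbers such that the sets $$\gamma_n=\{P\in\gamma : C_P(\theta_n,\sigma_n,h_n)\cap\gamma=\{P\}\}$$ satisfy $\gamma=\bigcup_{n}\gamma_n$ and $\mathcal H^1(\gamma_n)<\infty$ for every $n$. Moreover, if $\gamma$ is contained in a closed axis-parallel square of side length $L$, then $$\mathcal H^1(\gamma_n)\le \frac{2kL}{\cos\theta_n}\quad\text{for every } n;$$ in particular $\mathcal H^1(\gamma_n)\le 2k/\cos\theta_n$ if $\gamma$ lies in the unit square. -/

import Mathlib

open Set MeasureTheory
open scoped ENNReal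

namespace ConeCurve

noncomputable section

/-- The Euclidean plane. -/
abbrev Plane : Type := EuclideanSpace ℝ (Fin 2)

/-- The closed vertical double cone `{(x, y) : |y| ≥ tan φ * |x|}` with vertex at the origin. -/
def verticalCone (φ : ℝ) : Set Plane :=
  {v | Real.tan φ * |v 0| ≤ |v 1|}

/-- Counter-clockwise rotation of the plane about the origin by the angle `ρ`. -/
def rotate (ρ : ℝ) (v : Plane) : Plane :=
  !₂[Real.cos ρ * v 0 - Real.sin ρ * v 1, Real.sin ρ * v 0 + Real.cos ρ * v 1]

/-- The double cone `C(φ, ρ)`: the vertical double cone rotated by `ρ`. -/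
def cone (φ ρ : ℝ) : Set Plane :=
  rotate ρ '' verticalCone φ

/-- The double cone `C_P(φ, ρ)`, with vertex `P`. -/
def coneAt (P : Plane) (φ ρ : ℝ) : Set Plane :=
  {Q | Q - P ∈ cone φ ρ}

/-- The truncated double cone `C_P(φ, ρ, h)`. -/
def truncatedCone (P : Plane) (φ ρ h : ℝ) : Set Plane :=
  Metric.closedBall P h ∩ coneAt P φ ρ

/-- Every line contained in some cone `C_P(φ, ρ)` meets `K` in at most `k` points. -/
def ConeLinesMeetAtMost (K : Set Plane) (k : ℕ) (φ ρ : ℝ) : Prop :=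
  ∀ (P : Plane) (l : AffineSubspace ℝ Plane), Module.finrank ℝ l.direction = 1 →
    (l : Set Plane) ⊆ coneAt P φ ρ → ((l : Set Plane) ∩ K).encard ≤ k

/-- The parameters `(θ, σ, h)` of the nondegenerate truncated cones whose untruncated cone
lies in `C(φ, ρ)` (up to translation of the vertex). -/
def IsAdmissible (φ ρ θ σ h : ℝ) : Prop :=
  0 < θ ∧ θ < Real.pi / 2 ∧ 0 < h ∧ cone θ σ ⊆ cone φ ρ

/-- The points `P` of `K` with `C_P(θ, σ, h) ∩ K = {P}`. -/
def freePoints (K : Set Plane) (θ σ h : ℝ) : Set Plane :=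
  {P | P ∈ K ∧ truncatedCone P θ σ h ∩ K = {P}}

end

end ConeCurve

/-!
Write `K` for the image of `γ`, a compact set. The admissible rational triples form a countable
set, so two things have to be shown: every point of `K` is a free point for one of them, and the set
of free points for an admissible triple has the stated length.

*Covering.* Suppose `P ∈ K` is free for no admissible rational triple. Describe the lines through
`P` in `C_P(φ, ρ)` by their slopes in the rotated frame. Every open interval `J` of slopes contains
the slopes of a rational double cone (`exists_rat_cone_slope_mem`), so for each `r > 0` the curve
visits a point `Q ≠ P` with slope in `J` at distance less than `r` from `P`. Follow the curve during
the maximal connected set of times around this visit for which the same holds. The slope is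
continuous there, and it is not constant: each line meets `K` in finitely many points, so a constant
slope would make the curve itself constant on a set of times that is open and closed, and it would
never reach `P`. Hence the slopes met within distance `r` of `P` contain an open interval inside `J`
(`exists_Ioo_subset_image`). So for every `r` they contain an open dense set of slopes, and by
Baire's theorem one slope is met at points other than `P` arbitrarily close to `P`. The line with
this slope has infinitely many points in `K`, against the hypothesis
(`exists_rat_mem_freePoints`).

*Measure.* Let `S` be the set of free points for `(θ, σ, h)`, and let `p` be the orthogonal
projection along the axis of the cone `C(θ, σ)`. Two points of `S` at distance at most `h` do not
lie in each other's cone, so their distance is at most `1 / cos θ` times that of their projections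
(`dist_le_of_mem_freePoints`). Cut `S` into countably many disjoint Borel pieces of diameter at most
`h`; on each of them `p` is injective with `1 / cos θ`-Lipschitz inverse. The images of the pieces
are Borel sets by the Lusin–Souslin theorem, and they cover each point at most `k` times because the
fibers of `p` are lines contained in cones `C_P(φ, ρ)`. Integrating this multiplicity over an
interval containing the projection of `K` bounds the length of `S`
(`hausdorffMeasure_le_of_fibers`). The projection of a square of side length `L` has length at most
`(|cos σ| + |sin σ|) * L ≤ 2 * L`, which gives the constant.
-/

open Topology Filter

namespace ConeCurve

/-! ### Coordinates in a rotated frame -/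

/-- The first coordinate of `v` in the frame obtained by rotating the standard one by `σ`. -/
noncomputable def horiz (σ : ℝ) (v : Plane) : ℝ := Real.cos σ * v 0 + Real.sin σ * v 1

/-- The second coordinate of `v` in the frame obtained by rotating the standard one by `σ`,
so that the axis of `cone θ σ` is the line `horiz σ v = 0`. -/
noncomputable def vert (σ : ℝ) (v : Plane) : ℝ := -Real.sin σ * v 0 + Real.cos σ * v 1

@[fun_prop]
lemma continuous_horiz (σ : ℝ) : Continuous (horiz σ) := by
  unfold horiz; fun_prop

@[fun_prop]
lemma continuous_vert (σ : ℝ) : Continuous (vert σ) := by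
  unfold vert; fun_prop

lemma horiz_sub (σ : ℝ) (v w : Plane) : horiz σ (v - w) = horiz σ v - horiz σ w := by
  simp only [horiz, PiLp.sub_apply]; ring

lemma horiz_rotate (σ : ℝ) (v : Plane) : horiz σ (rotate σ v) = v 0 := by
  simp only [horiz, rotate, PiLp.toLp_apply, Matrix.cons_val_zero, Matrix.cons_val_one]
  linear_combination v 0 * Real.cos_sq_add_sin_sq σ

lemma vert_rotate (σ : ℝ) (v : Plane) : vert σ (rotate σ v) = v 1 := by
  simp only [vert, rotate, PiLp.toLp_apply, Matrix.cons_val_zero, Matrix.cons_val_one]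
  linear_combination v 1 * Real.cos_sq_add_sin_sq σ

lemma rotate_horiz_vert (σ : ℝ) (v : Plane) : rotate σ !₂[horiz σ v, vert σ v] = v := by
  ext i
  fin_cases i
  · simp only [horiz, vert, rotate, PiLp.toLp_apply, Matrix.cons_val_zero, Matrix.cons_val_one,
      Fin.zero_eta]
    linear_combination v 0 * Real.cos_sq_add_sin_sq σ
  · simp only [horiz, vert, rotate, PiLp.toLp_apply, Matrix.cons_val_zero, Matrix.cons_val_one,
      Fin.mk_one]
    linear_combination v 1 * Real.cos_sq_add_sin_sq σ

lemma mem_cone_iff {θ σ : ℝ} {v : Plane} :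
    v ∈ cone θ σ ↔ Real.tan θ * |horiz σ v| ≤ |vert σ v| := by
  constructor
  · rintro ⟨w, hw, rfl⟩
    rwa [horiz_rotate, vert_rotate]
  · intro h
    exact ⟨_, h, rotate_horiz_vert σ v⟩

lemma isClosed_cone (θ σ : ℝ) : IsClosed (cone θ σ) := by
  have : cone θ σ = {v | Real.tan θ * |horiz σ v| ≤ |vert σ v|} := by
    ext v; exact mem_cone_iff
  rw [this]
  exact isClosed_le (by fun_prop) (by fun_prop)

lemma norm_sq_eq_horiz_vert (σ : ℝ) (v : Plane) :
    ‖v‖ ^ 2 = horiz σ v ^ 2 + vert σ v ^ 2 := by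
  rw [EuclideanSpace.real_norm_sq_eq, Fin.sum_univ_two]
  simp only [horiz, vert]
  linear_combination -(v 0 ^ 2 + v 1 ^ 2) * Real.cos_sq_add_sin_sq σ

/-- Change of frame by the angle `σ - ρ`. -/
lemma horiz_eq_of_frame (ρ σ : ℝ) (v : Plane) :
    horiz ρ v = Real.cos (σ - ρ) * horiz σ v - Real.sin (σ - ρ) * vert σ v := by
  simp only [horiz, vert, Real.cos_sub, Real.sin_sub]
  linear_combination
    -(v 0 * Real.cos ρ + v 1 * Real.sin ρ) * Real.cos_sq_add_sin_sq σ

/-- Change of frame by the angle `σ - ρ`. -/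
lemma vert_eq_of_frame (ρ σ : ℝ) (v : Plane) :
    vert ρ v = Real.sin (σ - ρ) * horiz σ v + Real.cos (σ - ρ) * vert σ v := by
  simp only [horiz, vert, Real.cos_sub, Real.sin_sub]
  linear_combination
    -(v 1 * Real.cos ρ - v 0 * Real.sin ρ) * Real.cos_sq_add_sin_sq σ

lemma horiz_smul_rotate (σ c : ℝ) (w : Plane) : horiz σ (c • rotate σ w) = c * w 0 := by
  rw [← horiz_rotate σ w]
  simp only [horiz, PiLp.smul_apply, smul_eq_mul]; ring

lemma vert_smul_rotate (σ c : ℝ) (w : Plane) : vert σ (c • rotate σ w) = c * w 1 := by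
  rw [← vert_rotate σ w]
  simp only [vert, PiLp.smul_apply, smul_eq_mul]; ring

lemma smul_rotate (σ c : ℝ) (w : Plane) : c • rotate σ w = rotate σ (c • w) := by
  ext i
  fin_cases i <;>
  · simp [rotate]
    ring

/-! ### Lines in the cone -/

/-- The hypothesis on lines, for a line given by a point and a direction vector. -/
lemma ConeLinesMeetAtMost.encard_le {K : Set Plane} {k : ℕ} {φ ρ : ℝ}
    (hk : ConeLinesMeetAtMost K k φ ρ) (P : Plane) {e : Plane} (he : e ≠ 0)
    (hcone : ∀ c : ℝ, c • e ∈ cone φ ρ) :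
    {Q | Q ∈ K ∧ ∃ c : ℝ, Q - P = c • e}.encard ≤ k := by
  have hmem : ∀ Q, Q ∈ AffineSubspace.mk' P (Submodule.span ℝ {e}) ↔ ∃ c : ℝ, Q - P = c • e := by
    intro Q
    rw [AffineSubspace.mem_mk', vsub_eq_sub, Submodule.mem_span_singleton]
    simp only [eq_comm]
  refine le_trans (encard_le_encard ?_) (hk P (AffineSubspace.mk' P (Submodule.span ℝ {e})) ?_ ?_)
  · rintro Q ⟨hQ, hc⟩
    exact ⟨(hmem Q).2 hc, hQ⟩
  · rw [AffineSubspace.direction_mk', finrank_span_singleton he]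
  · intro Q hQ
    obtain ⟨c, hc⟩ := (hmem Q).1 hQ
    change Q - P ∈ cone φ ρ
    rw [hc]
    exact hcone c

/-- A line through `P` in the cone `C_P(φ, ρ)`, described by its slope `x = horiz / vert` in the
frame of the cone. -/
lemma ConeLinesMeetAtMost.encard_slope_le {K : Set Plane} {k : ℕ} {φ ρ : ℝ}
    (hk : ConeLinesMeetAtMost K k φ ρ) (P : Plane) {x : ℝ} (hx : Real.tan φ * |x| ≤ 1) :
    {Q | Q ∈ K ∧ horiz ρ (Q - P) = x * vert ρ (Q - P)}.encard ≤ k := by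
  have he : rotate ρ !₂[x, 1] ≠ 0 := by
    intro h
    have := vert_rotate ρ !₂[x, 1]
    rw [h] at this
    simp [vert] at this
  refine le_trans (encard_le_encard ?_) (hk.encard_le P he ?_)
  · rintro Q ⟨hQ, h⟩
    refine ⟨hQ, vert ρ (Q - P), ?_⟩
    rw [smul_rotate, ← rotate_horiz_vert ρ (Q - P), vert_rotate, h]
    congr 1
    ext i
    fin_cases i <;> simp [mul_comm]
  · intro c
    rw [mem_cone_iff, horiz_smul_rotate, vert_smul_rotate]
    simp only [Matrix.cons_val_zero, Matrix.cons_val_one, abs_mul, mul_one]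
    nlinarith [abs_nonneg c]

/-- The lines parallel to the axis of a cone contained in `C(φ, ρ)` meet `K` in at most `k`
points. -/
lemma ConeLinesMeetAtMost.encard_horiz_fiber_le {K : Set Plane} {k : ℕ} {φ ρ θ σ : ℝ}
    (hk : ConeLinesMeetAtMost K k φ ρ) (hsub : cone θ σ ⊆ cone φ ρ) (x : ℝ) :
    (K ∩ horiz σ ⁻¹' {x}).encard ≤ k := by
  have he : rotate σ !₂[0, 1] ≠ 0 := by
    intro h
    have := vert_rotate σ !₂[0, 1]
    rw [h] at this
    simp [vert] at this
  refine le_trans (encard_le_encard ?_) (hk.encard_le (rotate σ !₂[x, 0]) he ?_)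
  · rintro Q ⟨hQ, hx⟩
    refine ⟨hQ, vert σ Q, ?_⟩
    have hx : horiz σ Q = x := hx
    conv_lhs => rw [← rotate_horiz_vert σ Q, hx]
    ext i
    fin_cases i <;> · simp [rotate]; ring
  · intro c
    apply hsub
    rw [mem_cone_iff, horiz_smul_rotate]
    simp

/-! ### Narrow rational cones -/

/-- Every nonempty open interval of slopes contains the slopes of a nondegenerate double cone
with rational parameters: take its axis in the interval and its aperture small. -/
lemma exists_rat_cone_slope_mem (ρ : ℝ) {a b : ℝ} (hab : a < b) :
    ∃ θ σ : ℚ, 0 < (θ : ℝ) ∧ (θ : ℝ) < Real.pi / 2 ∧ ∀ v ∈ cone θ σ, v ≠ 0 →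
      vert ρ v ≠ 0 ∧ horiz ρ v / vert ρ v ∈ Ioo a b := by
  obtain ⟨x, hax, hxb⟩ := exists_between hab
  -- The slope in the frame `ρ` of a vector of slope `y` in the frame `σ` is `g (y, σ)`.
  set g : ℝ × ℝ → ℝ := fun z ↦ (Real.cos (z.2 - ρ) * z.1 - Real.sin (z.2 - ρ)) /
    (Real.sin (z.2 - ρ) * z.1 + Real.cos (z.2 - ρ)) with hg
  set σ₀ : ℝ := ρ - Real.arctan x with hσ₀
  have hs : σ₀ - ρ = -Real.arctan x := by rw [hσ₀]; ring
  have hcos : 0 < Real.cos (Real.arctan x) := Real.cos_arctan_pos x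
  have hden : ∀ᶠ z in 𝓝 ((0 : ℝ), σ₀),
      0 < Real.sin (z.2 - ρ) * z.1 + Real.cos (z.2 - ρ) := by
    have : Continuous fun z : ℝ × ℝ ↦ Real.sin (z.2 - ρ) * z.1 + Real.cos (z.2 - ρ) := by
      fun_prop
    refine this.continuousAt.eventually (lt_mem_nhds ?_)
    simpa [hs] using hcos
  have hgx : g (0, σ₀) = x := by
    simp only [hg, hs, mul_zero, zero_sub, zero_add, Real.sin_neg, Real.cos_neg, neg_neg]
    rw [← Real.tan_eq_sin_div_cos, Real.tan_arctan]
  have hgcont : ContinuousAt g (0, σ₀) := by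
    refine ContinuousAt.div (by fun_prop) (by fun_prop) ?_
    simpa [hs] using hcos.ne'
  have hev : ∀ᶠ z in 𝓝 ((0 : ℝ), σ₀), g z ∈ Ioo a b :=
    hgcont.eventually (by rw [hgx]; exact Ioo_mem_nhds hax hxb)
  obtain ⟨ε, hε, hball⟩ := Metric.eventually_nhds_iff.1 (hden.and hev)
  obtain ⟨σ, hσ1, hσ2⟩ := exists_rat_btwn (show σ₀ - ε < σ₀ by linarith)
  -- The aperture: `θ` lies above `arctan (2 / ε)`, so that the slopes in the frame `σ` are
  -- smaller than `ε`.
  obtain ⟨θ, hθ1, hθ2⟩ := exists_rat_btwn (Real.arctan_lt_pi_div_two (2 / ε))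
  have hθ0 : 0 < (θ : ℝ) := lt_of_le_of_lt (Real.arctan_nonneg.2 (by positivity)) hθ1
  have htan : 2 / ε < Real.tan θ := by
    rw [← Real.tan_arctan (2 / ε)]
    exact Real.tan_lt_tan_of_lt_of_lt_pi_div_two (Real.neg_pi_div_two_lt_arctan _) hθ2 hθ1
  have htan0 : 0 < Real.tan θ := lt_trans (by positivity) htan
  refine ⟨θ, σ, hθ0, hθ2, fun v hv hv0 ↦ ?_⟩
  rw [mem_cone_iff] at hv
  have hvert : vert σ v ≠ 0 := by
    intro h
    rw [h, abs_zero] at hv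
    have hh : horiz σ v = 0 := by
      by_contra hne
      have := mul_pos htan0 (abs_pos.2 hne)
      linarith
    have := norm_sq_eq_horiz_vert σ v
    rw [h, hh] at this
    exact hv0 (norm_eq_zero.1 (by simpa using this))
  have hy : |horiz σ v / vert σ v| < ε := by
    rw [abs_div, div_lt_iff₀ (abs_pos.2 hvert)]
    have h1 : 2 / ε * |horiz σ v| ≤ |vert σ v| :=
      (mul_le_mul_of_nonneg_right htan.le (abs_nonneg _)).trans hv
    have h2 : 2 * |horiz σ v| ≤ ε * |vert σ v| := by
      have := mul_le_mul_of_nonneg_left h1 hε.le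
      rwa [← mul_assoc, mul_div_cancel₀ _ hε.ne'] at this
    have h3 := mul_pos hε (abs_pos.2 hvert)
    linarith
  obtain ⟨hd, hmem⟩ := hball (y := (horiz σ v / vert σ v, (σ : ℝ))) (by
    rw [Prod.dist_eq, max_lt_iff]
    refine ⟨by simpa only [Real.dist_eq, sub_zero] using hy, ?_⟩
    rw [Real.dist_eq, abs_lt]
    constructor <;> simp only <;> linarith)
  have hvρ : vert ρ v = vert σ v * (Real.sin (σ - ρ) * (horiz σ v / vert σ v) +
      Real.cos (σ - ρ)) := by
    rw [vert_eq_of_frame ρ σ]; field_simp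
  have hhρ : horiz ρ v = vert σ v * (Real.cos (σ - ρ) * (horiz σ v / vert σ v) -
      Real.sin (σ - ρ)) := by
    rw [horiz_eq_of_frame ρ σ]; field_simp
  refine ⟨by rw [hvρ]; exact mul_ne_zero hvert hd.ne', ?_⟩
  rw [hvρ, hhρ, mul_div_mul_left _ _ hvert]
  exact hmem

lemma cone_subset_of_slope_mem {φ ρ θ σ a b : ℝ} (hφ : 0 < Real.tan φ)
    (ha : -(1 / Real.tan φ) ≤ a) (hb : b ≤ 1 / Real.tan φ)
    (h : ∀ v ∈ cone θ σ, v ≠ 0 → vert ρ v ≠ 0 ∧ horiz ρ v / vert ρ v ∈ Ioo a b) :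
    cone θ σ ⊆ cone φ ρ := by
  intro v hv
  rw [mem_cone_iff]
  by_cases hv0 : v = 0
  · simp [hv0, horiz, vert]
  obtain ⟨hne, h1, h2⟩ := h v hv hv0
  have : |horiz ρ v / vert ρ v| ≤ 1 / Real.tan φ := abs_le.2 ⟨by linarith, by linarith⟩
  rw [abs_div, div_le_div_iff₀ (abs_pos.2 hne) hφ] at this
  linarith

/-! ### Free points cover the curve -/

/-- A continuous real function on an open set `U` takes an open interval of values along a path
that visits `U` but does not stay in it, provided each value is taken at finitely many points of
the path. Indeed it is not constant on a connected component of the times spent in `U`: otherwise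
the path would be constant there, so the component would be open and closed. -/
lemma exists_Ioo_subset_image {T X : Type*} [TopologicalSpace T] [PreconnectedSpace T]
    [LocallyConnectedSpace T] [MetricSpace X] {γ : T → X} (hγ : Continuous γ) {U : Set X}
    (hU : IsOpen U) {f : X → ℝ} (hf : ContinuousOn f U)
    (hfin : ∀ Q ∈ U, (range γ ∩ U ∩ f ⁻¹' {f Q}).Finite) {t₀ t₁ : T} (h₀ : γ t₀ ∈ U)
    (h₁ : γ t₁ ∉ U) : ∃ a b, a < b ∧ Ioo a b ⊆ f '' (range γ ∩ U) := by
  set V := connectedComponentIn (γ ⁻¹' U) t₀ with hVdef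
  have hVpre : IsPreconnected V := isPreconnected_connectedComponentIn
  have hVsub : V ⊆ γ ⁻¹' U := connectedComponentIn_subset _ _
  have hV0 : t₀ ∈ V := mem_connectedComponentIn h₀
  have himg : IsPreconnected (f '' (γ '' V)) :=
    (hVpre.image γ hγ.continuousOn).image f (hf.mono (image_subset_iff.2 hVsub))
  by_cases hsub : (f '' (γ '' V)).Subsingleton
  · exfalso
    have hγV : γ '' V ⊆ range γ ∩ U ∩ f ⁻¹' {f (γ t₀)} := by
      rintro _ ⟨t, ht, rfl⟩
      exact ⟨⟨mem_range_self t, hVsub ht⟩, hsub ⟨_, ⟨t, ht, rfl⟩, rfl⟩ ⟨_, ⟨t₀, hV0, rfl⟩, rfl⟩⟩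
    have hconst : (γ '' V).Subsingleton :=
      (hfin _ h₀).countable.isTotallyDisconnected _ hγV (hVpre.image γ hγ.continuousOn)
    have hcl : closure V ⊆ γ ⁻¹' {γ t₀} :=
      closure_minimal (fun t ht ↦ hconst ⟨t, ht, rfl⟩ ⟨t₀, hV0, rfl⟩)
        (isClosed_singleton.preimage hγ)
    have hclV : closure V ⊆ V :=
      hVpre.closure.subset_connectedComponentIn (subset_closure hV0) (fun t ht ↦ by
        have : γ t = γ t₀ := hcl ht
        rw [mem_preimage, this]; exact h₀)
    have hclopen : IsClopen V :=
      ⟨isClosed_of_closure_subset hclV, (hU.preimage hγ).connectedComponentIn⟩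
    have := hclopen.eq_univ ⟨t₀, hV0⟩
    exact h₁ (hVsub (this ▸ mem_univ t₁))
  · have hsub' := not_subsingleton_iff.1 hsub
    obtain ⟨a, ha, b, hb, hab⟩ := hsub'.exists_lt
    refine ⟨a, b, hab, Ioo_subset_Icc_self.trans ((himg.Icc_subset ha hb).trans ?_)⟩
    apply image_mono
    rintro _ ⟨t, ht, rfl⟩
    exact ⟨mem_range_self t, hVsub ht⟩

instance locallyConnectedSpace_unitInterval : LocallyConnectedSpace unitInterval :=
  (isQuotientMap_projIcc (h := zero_le_one (α := ℝ))).isCoinducing.locallyConnectedSpace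

/-- Each point of the curve is the only point of the curve in some truncated rational cone.
Otherwise, for each `r`, the slopes at `P` of the points of the curve at distance less than `r`
from `P` contain an open dense set of the slopes in `C(φ, ρ)`; by Baire's theorem some line
through `P` then carries points of the curve, other than `P`, arbitrarily close to `P`. -/
lemma exists_rat_mem_freePoints {γ : unitInterval → Plane} (hγ : Continuous γ) {k : ℕ} {φ ρ : ℝ}
    (hφ₀ : 0 < φ) (hφ₁ : φ < Real.pi / 2) (hk : ConeLinesMeetAtMost (range γ) k φ ρ)
    {P : Plane} (hP : P ∈ range γ) :
    ∃ θ σ h : ℚ, IsAdmissible φ ρ θ σ h ∧ P ∈ freePoints (range γ) θ σ h := by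
  by_contra! hcon
  have htan : 0 < Real.tan φ := Real.tan_pos_of_pos_of_lt_pi_div_two hφ₀ hφ₁
  set m : ℝ := 1 / Real.tan φ with hm
  have hm0 : 0 < m := by positivity
  have hslope : ∀ x : ℝ, |x| ≤ m → Real.tan φ * |x| ≤ 1 := by
    intro x hx
    rw [hm, le_div_iff₀ htan] at hx
    linarith
  set W : ℕ → Set ℝ := fun n ↦ {x | ∃ Q ∈ range γ, vert ρ (Q - P) ≠ 0 ∧
    dist Q P < 1 / ((n : ℝ) + 1) ∧ horiz ρ (Q - P) / vert ρ (Q - P) = x} with hW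
  have key : ∀ n, ∀ a b : ℝ, -m ≤ a → b ≤ m → a < b → (interior (W n) ∩ Ioo a b).Nonempty := by
    intro n a b ha hb hab
    have hn : (0 : ℝ) < 1 / ((n : ℝ) + 1) := by positivity
    obtain ⟨θ, σ, hθ0, hθ1, hcone⟩ := exists_rat_cone_slope_mem ρ hab
    obtain ⟨h, hh0, hh1⟩ := exists_rat_btwn hn
    have hnot := hcon θ σ h ⟨hθ0, hθ1, hh0, cone_subset_of_slope_mem htan ha hb hcone⟩
    obtain ⟨Q, hQ, hQP⟩ : ∃ Q ∈ truncatedCone P θ σ h ∩ range γ, Q ≠ P := by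
      by_contra! hall
      refine hnot ⟨hP, Subset.antisymm hall ?_⟩
      rintro Q hQ
      obtain rfl : Q = P := hQ
      refine ⟨⟨Metric.mem_closedBall_self hh0.le, ?_⟩, hP⟩
      change Q - Q ∈ cone _ _
      simp [mem_cone_iff, horiz, vert]
    obtain ⟨⟨hQh, hQc⟩, t₀, rfl⟩ := hQ
    obtain ⟨t₁, rfl⟩ := hP
    obtain ⟨hne, hmem⟩ := hcone _ hQc (sub_ne_zero.2 hQP)
    set f : Plane → ℝ := fun Q ↦ horiz ρ (Q - γ t₁) / vert ρ (Q - γ t₁) with hf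
    set U₀ : Set Plane := {Q | vert ρ (Q - γ t₁) ≠ 0} ∩ Metric.ball (γ t₁) (1 / ((n : ℝ) + 1))
      with hU₀
    have hU₀o : IsOpen U₀ :=
      (isOpen_ne_fun (by fun_prop) continuous_const).inter Metric.isOpen_ball
    have hfc : ContinuousOn f U₀ :=
      ContinuousOn.div (by fun_prop) (by fun_prop) (fun Q hQ ↦ hQ.1)
    have hUo : IsOpen (U₀ ∩ f ⁻¹' Ioo a b) := hfc.isOpen_inter_preimage hU₀o isOpen_Ioo
    obtain ⟨c, d, hcd, hsub⟩ := exists_Ioo_subset_image hγ hUo (hfc.mono inter_subset_left)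
      (t₀ := t₀) (t₁ := t₁) (fun Q hQ ↦ by
        have hle := hk.encard_slope_le (γ t₁) (hslope (f Q)
          (abs_le.2 ⟨by linarith [hQ.2.1], by linarith [hQ.2.2]⟩))
        refine (finite_of_encard_le_coe hle).subset ?_
        rintro Q' ⟨⟨hQ'K, hQ'U⟩, hQ'f⟩
        refine ⟨hQ'K, ?_⟩
        have hQ'f : f Q' = f Q := hQ'f
        rw [← hQ'f, hf]
        exact (div_mul_cancel₀ _ hQ'U.1.1).symm)
      ⟨⟨hne, Metric.mem_ball.2 (lt_of_le_of_lt (Metric.mem_closedBall.1 hQh) hh1)⟩, hmem⟩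
      (fun h ↦ h.1.1 (by simp [vert]))
    obtain ⟨x, hx⟩ := nonempty_Ioo.2 hcd
    refine ⟨x, mem_interior.2 ⟨Ioo c d, ?_, isOpen_Ioo, hx⟩, ?_⟩
    · intro y hy
      obtain ⟨Q, ⟨hQK, hQU⟩, rfl⟩ := hsub hy
      exact ⟨Q, hQK, hQU.1.1, hQU.1.2, rfl⟩
    · obtain ⟨Q, ⟨-, hQU⟩, rfl⟩ := hsub hx
      exact hQU.2
  -- The slopes outside the closed interval of the cone are added, so that Baire's theorem applies
  -- on all of `ℝ`.
  have hdense : Dense (⋂ n, (interior (W n) ∪ (Icc (-m) m)ᶜ)) := by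
    refine dense_iInter_of_isOpen
      (fun n ↦ isOpen_interior.union isClosed_Icc.isOpen_compl) (fun n ↦ ?_)
    rw [dense_iff_inter_open]
    rintro O hO ⟨y, hy⟩
    by_cases hOI : O ⊆ Icc (-m) m
    · obtain ⟨ε, hε, hball⟩ := Metric.isOpen_iff.1 hO y hy
      rw [Real.ball_eq_Ioo] at hball
      have hIcc : Icc (y - ε) (y + ε) ⊆ Icc (-m) m := by
        rw [← closure_Ioo (by linarith)]
        exact closure_minimal (hball.trans hOI) isClosed_Icc
      obtain ⟨x, hxW, hx⟩ := key n (y - ε) (y + ε) (hIcc ⟨le_rfl, by linarith⟩).1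
        (hIcc ⟨by linarith, le_rfl⟩).2 (by linarith)
      exact ⟨x, hball hx, Or.inl hxW⟩
    · obtain ⟨x, hxO, hx⟩ := not_subset.1 hOI
      exact ⟨x, hxO, Or.inr hx⟩
  obtain ⟨x, hxm, hx⟩ := hdense.inter_open_nonempty _ (isOpen_Ioo (a := -m) (b := m))
    ⟨0, by linarith, hm0⟩
  have hxW : ∀ n, x ∈ W n := fun n ↦
    interior_subset ((mem_iInter.1 hx n).resolve_right fun h ↦ h (Ioo_subset_Icc_self hxm))
  have hfin : {Q | Q ∈ range γ ∧ horiz ρ (Q - P) = x * vert ρ (Q - P)}.Finite :=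
    finite_of_encard_le_coe
      (hk.encard_slope_le P (hslope x (abs_le.2 ⟨hxm.1.le, hxm.2.le⟩)))
  -- The line of slope `x` has finitely many points of the curve, so those other than `P` stay away
  -- from `P`.
  obtain ⟨ε, hε, hball⟩ := Metric.isOpen_iff.1
    ((hfin.subset (sdiff_subset (t := {P}))).isClosed.isOpen_compl) P (fun h ↦ h.2 rfl)
  obtain ⟨n, hn⟩ := exists_nat_one_div_lt hε
  obtain ⟨Q, hQK, hQv, hQd, hQx⟩ := hxW n
  refine hball (Metric.mem_ball.2 (hQd.trans hn)) ⟨⟨hQK, ?_⟩, ?_⟩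
  · rw [← hQx, div_mul_cancel₀ _ hQv]
  · rintro rfl
    exact hQv (by simp [vert])

/-! ### The measure of the free points -/

/-- The free points form a Borel set: a point of the compact set `K` fails to be free exactly when,
for some `n`, its truncated cone contains a point of `K` at distance at least `1 / (n + 1)`, and
for each `n` this condition defines a compact set. -/
lemma measurableSet_freePoints {K : Set Plane} (hK : IsCompact K) {θ σ h : ℝ} (hh : 0 ≤ h) :
    MeasurableSet (freePoints K θ σ h) := by
  set N : ℕ → Set (Plane × Plane) := fun n ↦ (K ×ˢ K) ∩
    ({z | 1 / ((n : ℝ) + 1) ≤ dist z.2 z.1} ∩ ({z | dist z.2 z.1 ≤ h} ∩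
      (fun z ↦ z.2 - z.1) ⁻¹' cone θ σ)) with hN
  have hNc : ∀ n, IsCompact (N n) := fun n ↦ (hK.prod hK).inter_right
    ((isClosed_le continuous_const (by fun_prop)).inter
      ((isClosed_le (by fun_prop) continuous_const).inter
        ((isClosed_cone θ σ).preimage (by fun_prop))))
  have : freePoints K θ σ h = K \ ⋃ n, Prod.fst '' N n := by
    ext P
    simp only [freePoints, mem_ofPred_eq, Set.mem_sdiff, mem_iUnion, not_exists]
    refine and_congr_right fun hP ↦ ⟨?_, ?_⟩
    · rintro hfree n ⟨⟨P', Q⟩, ⟨⟨hP', hQ⟩, h1, h2, h3⟩, rfl⟩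
      have : Q ∈ truncatedCone P' θ σ h ∩ K := ⟨⟨h2, h3⟩, hQ⟩
      rw [hfree] at this
      obtain rfl : Q = P' := this
      have h1 : 1 / ((n : ℝ) + 1) ≤ dist Q Q := h1
      rw [dist_self] at h1
      have : (0 : ℝ) < 1 / ((n : ℝ) + 1) := by positivity
      linarith
    · intro hnot
      refine Subset.antisymm ?_ ?_
      · rintro Q ⟨⟨h2, h3⟩, hQ⟩
        by_contra hne
        obtain ⟨n, hn⟩ := exists_nat_one_div_lt (dist_pos.2 hne)
        exact hnot n ⟨(P, Q), ⟨⟨hP, hQ⟩, hn.le, h2, h3⟩, rfl⟩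
      · rintro Q hQ
        obtain rfl : Q = P := hQ
        refine ⟨⟨Metric.mem_closedBall_self hh, ?_⟩, hP⟩
        change Q - Q ∈ cone _ _
        simp [mem_cone_iff, horiz, vert]
  rw [this]
  exact hK.measurableSet.diff
    (MeasurableSet.iUnion fun n ↦ ((hNc n).image continuous_fst).measurableSet)

/-- Sets that are pairwise disjoint and whose union meets each fiber of `p` in at most `k` points
have images covering each point at most `k` times. -/
lemma tsum_indicator_image_le {X : Type*} [Nonempty X] {A : ℕ → Set X}
    (hA : Pairwise (Function.onFun Disjoint A)) {p : X → ℝ} {k : ℕ}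
    (hfib : ∀ x, ((⋃ i, A i) ∩ p ⁻¹' {x}).encard ≤ k) (x : ℝ) :
    ∑' i, (p '' A i).indicator (1 : ℝ → ℝ≥0∞) x ≤ k := by
  classical
  refine ENNReal.tsum_le_of_sum_range_le fun n ↦ ?_
  set s := (Finset.range n).filter fun i ↦ x ∈ p '' A i with hs
  have hsum : ∑ i ∈ Finset.range n, (p '' A i).indicator (1 : ℝ → ℝ≥0∞) x = (s.card : ℝ≥0∞) := by
    simp only [indicator_apply, Pi.one_apply, ← Finset.sum_filter, Finset.sum_const,
      nsmul_eq_mul, mul_one, hs]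
  rw [hsum]
  have hex : ∀ i ∈ s, ∃ y ∈ A i, p y = x := fun i hi ↦ (Finset.mem_filter.1 hi).2
  choose! y hyA hyx using hex
  have hle : (s : Set ℕ).encard ≤ ((⋃ i, A i) ∩ p ⁻¹' {x}).encard := by
    refine encard_le_encard_of_injOn (f := y)
      (fun i hi ↦ ⟨mem_iUnion.2 ⟨i, hyA i hi⟩, hyx i hi⟩) ?_
    intro i hi j hj hij
    by_contra hne
    exact disjoint_left.1 (hA hne) (hyA i hi) (hij ▸ hyA j hj)
  have := hle.trans (hfib x)
  rw [encard_coe_eq_coe_finsetCard] at this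
  exact_mod_cast this

/-- A Borel set on which nearby points are at most `C` times as far apart as their images under `p`,
and which meets each fiber of `p` in at most `k` points, has length at most `C * k` times the
length of an interval containing its image: cut it into small disjoint pieces, on which `p` is
injective, and count how often the images of the pieces overlap. -/
lemma hausdorffMeasure_le_of_fibers {X : Type*} [MetricSpace X] [CompleteSpace X]
    [SecondCountableTopology X] [MeasurableSpace X] [BorelSpace X] {S : Set X}
    (hS : MeasurableSet S) {p : X → ℝ} (hp : Continuous p) {C : NNReal} {h : ℝ} (hh : 0 < h)
    (hexp : ∀ P ∈ S, ∀ Q ∈ S, dist P Q ≤ h → dist P Q ≤ C * dist (p P) (p Q)) {k : ℕ}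
    (hfib : ∀ x, (S ∩ p ⁻¹' {x}).encard ≤ k) {c d : ℝ} (himg : p '' S ⊆ Icc c d) :
    μH[1] S ≤ C * (k * ENNReal.ofReal (d - c)) := by
  rcases S.eq_empty_or_nonempty with rfl | ⟨P₀, -⟩
  · simp
  have : Nonempty X := ⟨P₀⟩
  set B : ℕ → Set X := fun n ↦ S ∩ Metric.ball (TopologicalSpace.denseSeq X n) (h / 2) with hB
  set A : ℕ → Set X := disjointed B with hAdef
  have hAB : ∀ n, A n ⊆ B n := disjointed_subset B
  have hAm : ∀ n, MeasurableSet (A n) :=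
    MeasurableSet.disjointed fun n ↦ hS.inter Metric.isOpen_ball.measurableSet
  have hAU : ⋃ n, A n = S := by
    rw [hAdef, iUnion_disjointed, hB, ← inter_iUnion, inter_eq_left]
    intro P _
    obtain ⟨n, hn⟩ := (TopologicalSpace.denseRange_denseSeq X).exists_dist_lt P (half_pos hh)
    exact mem_iUnion.2 ⟨n, hn⟩
  have hAexp : ∀ n, ∀ P ∈ A n, ∀ Q ∈ A n, dist P Q ≤ C * dist (p P) (p Q) := by
    intro n P hP Q hQ
    refine hexp P (hAB n hP).1 Q (hAB n hQ).1 ?_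
    have h1 := Metric.mem_ball.1 (hAB n hP).2
    have h2 := Metric.mem_ball.1 (hAB n hQ).2
    have h3 := dist_triangle_right P Q (TopologicalSpace.denseSeq X n)
    linarith
  have hinj : ∀ n, InjOn p (A n) := by
    intro n P hP Q hQ hPQ
    have := hAexp n P hP Q hQ
    rw [hPQ, dist_self, mul_zero] at this
    exact dist_le_zero.1 this
  have hpm : ∀ n, MeasurableSet (p '' A n) := fun n ↦
    (hAm n).image_of_continuousOn_injOn hp.continuousOn (hinj n)
  have hpiece : ∀ n, μH[1] (A n) ≤ C * volume (p '' A n) := by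
    intro n
    have hinv : LeftInvOn (Function.invFunOn p (A n)) p (A n) := (hinj n).leftInvOn_invFunOn
    have hlip : LipschitzOnWith C (Function.invFunOn p (A n)) (p '' A n) := by
      refine LipschitzOnWith.of_dist_le_mul ?_
      rintro _ ⟨P, hP, rfl⟩ _ ⟨Q, hQ, rfl⟩
      rw [hinv hP, hinv hQ]
      exact hAexp n P hP Q hQ
    have := hlip.hausdorffMeasure_image_le (d := 1) zero_le_one
    rwa [hinv.image_image, hausdorffMeasure_real, ENNReal.rpow_one] at this
  calc μH[1] S = μH[1] (⋃ n, A n) := by rw [hAU]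
    _ ≤ ∑' n, μH[1] (A n) := measure_iUnion_le _
    _ ≤ ∑' n, C * volume (p '' A n) := ENNReal.tsum_le_tsum hpiece
    _ = C * ∑' n, volume (p '' A n) := ENNReal.tsum_mul_left
    _ = C * ∫⁻ x, ∑' n, (p '' A n).indicator (1 : ℝ → ℝ≥0∞) x := by
      rw [lintegral_tsum fun n ↦ (measurable_one.indicator (hpm n)).aemeasurable]
      simp only [lintegral_indicator_one (hpm _)]
    _ ≤ C * ∫⁻ x, (Icc c d).indicator (fun _ ↦ (k : ℝ≥0∞)) x := by
      gcongr with x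
      by_cases hx : x ∈ Icc c d
      · rw [indicator_of_mem hx]
        exact tsum_indicator_image_le (disjoint_disjointed B) (by rwa [hAU]) x
      · have : ∀ n, x ∉ p '' A n := fun n hn ↦
          hx (himg (image_mono ((hAB n).trans inter_subset_left) hn))
        simp [this]
    _ = C * (k * ENNReal.ofReal (d - c)) := by
      rw [lintegral_indicator_const measurableSet_Icc, Real.volume_Icc]

/-- Two free points at distance at most `h` are not in each other's cone, so that their distance
is controlled by their distance across the axis of the cone. -/
lemma dist_le_of_mem_freePoints {K : Set Plane} {θ σ h : ℝ} (hθ₀ : 0 < θ)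
    (hθ₁ : θ < Real.pi / 2) {P Q : Plane} (hP : P ∈ freePoints K θ σ h) (hQ : Q ∈ K)
    (hPQ : dist P Q ≤ h) : dist P Q ≤ 1 / Real.cos θ * dist (horiz σ P) (horiz σ Q) := by
  have hcos : 0 < Real.cos θ := Real.cos_pos_of_mem_Ioo ⟨by linarith, hθ₁⟩
  by_cases hne : Q = P
  · simp [hne]
  have hnot : Q - P ∉ cone θ σ := by
    intro hmem
    have : Q ∈ truncatedCone P θ σ h ∩ K := ⟨⟨by rwa [Metric.mem_closedBall'], hmem⟩, hQ⟩
    rw [hP.2] at this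
    exact hne this
  rw [mem_cone_iff, not_le, Real.tan_eq_sin_div_cos, div_mul_eq_mul_div, lt_div_iff₀ hcos] at hnot
  have hsin : 0 < Real.sin θ := Real.sin_pos_of_pos_of_lt_pi hθ₀ (by linarith)
  rw [dist_comm P Q, dist_comm (horiz σ P), dist_eq_norm, Real.dist_eq, ← horiz_sub, one_div,
    inv_mul_eq_div, le_div_iff₀ hcos]
  refine abs_le_of_sq_le_sq' ?_ (abs_nonneg _) |>.2
  have hsq : (|vert σ (Q - P)| * Real.cos θ) ^ 2 ≤ (Real.sin θ * |horiz σ (Q - P)|) ^ 2 :=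
    pow_le_pow_left₀ (by positivity) hnot.le 2
  rw [mul_pow, mul_pow, sq_abs, sq_abs] at hsq
  rw [mul_pow, norm_sq_eq_horiz_vert σ, sq_abs]
  nlinarith [Real.cos_sq_add_sin_sq θ]

/-- The projection of an axis-parallel square of side length `L` to any line has length at most
`2 * L`. -/
lemma horiz_mem_Icc_of_mem_square (σ : ℝ) {a v : Plane} {L : ℝ}
    (h : ∀ i, a i ≤ v i ∧ v i ≤ a i + L) :
    horiz σ v ∈ Icc (horiz σ a + (Real.cos σ + Real.sin σ) * (L / 2) - L)
      (horiz σ a + (Real.cos σ + Real.sin σ) * (L / 2) + L) := by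
  have h0 := h 0
  have h1 := h 1
  have b0 : |v 0 - a 0 - L / 2| ≤ L / 2 := abs_le.2 ⟨by linarith, by linarith⟩
  have b1 : |v 1 - a 1 - L / 2| ≤ L / 2 := abs_le.2 ⟨by linarith, by linarith⟩
  have c0 : |Real.cos σ * (v 0 - a 0 - L / 2)| ≤ L / 2 := by
    rw [abs_mul]
    exact (mul_le_of_le_one_left (abs_nonneg _) (Real.abs_cos_le_one σ)).trans b0
  have c1 : |Real.sin σ * (v 1 - a 1 - L / 2)| ≤ L / 2 := by
    rw [abs_mul]
    exact (mul_le_of_le_one_left (abs_nonneg _) (Real.abs_sin_le_one σ)).trans b1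
  rw [abs_le] at c0 c1
  simp only [horiz, mem_Icc]
  constructor <;> nlinarith

lemma hausdorffMeasure_freePoints_le {K : Set Plane} (hK : IsCompact K) {k : ℕ} {φ ρ θ σ h : ℝ}
    (hk : ConeLinesMeetAtMost K k φ ρ) (hadm : IsAdmissible φ ρ θ σ h) {a : Plane} {L : ℝ}
    (hsq : ∀ v ∈ K, ∀ i, a i ≤ v i ∧ v i ≤ a i + L) :
    μH[1] (freePoints K θ σ h) ≤ ENNReal.ofReal (2 * k * L / Real.cos θ) := by
  obtain ⟨hθ₀, hθ₁, hh, hsub⟩ := hadm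
  have hcos : 0 < Real.cos θ := Real.cos_pos_of_mem_Ioo ⟨by linarith, hθ₁⟩
  have hle := hausdorffMeasure_le_of_fibers (measurableSet_freePoints hK (θ := θ) (σ := σ) hh.le)
    (continuous_horiz σ) (C := (1 / Real.cos θ).toNNReal) hh (fun P hP Q hQ hPQ ↦ by
      rw [Real.coe_toNNReal _ (by positivity)]
      exact dist_le_of_mem_freePoints hθ₀ hθ₁ hP hQ.1 hPQ)
    (fun x ↦ (encard_le_encard (inter_subset_inter_left _ fun P hP ↦ hP.1)).trans
      (hk.encard_horiz_fiber_le hsub x))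
    (image_subset_iff.2 fun P hP ↦ horiz_mem_Icc_of_mem_square σ (hsq P hP.1))
  refine hle.trans (le_of_eq ?_)
  rw [← ENNReal.ofReal, ← ENNReal.ofReal_natCast, ← ENNReal.ofReal_mul (by positivity),
    ← ENNReal.ofReal_mul (by positivity)]
  congr 1
  ring

/-- A bounded set lies in an axis-parallel square. -/
lemma exists_square_of_isCompact {K : Set Plane} (hK : IsCompact K) :
    ∃ (a : Plane) (L : ℝ), ∀ v ∈ K, ∀ i, a i ≤ v i ∧ v i ≤ a i + L := by
  obtain ⟨R, hR⟩ := hK.isBounded.exists_norm_le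
  refine ⟨!₂[-R, -R], 2 * R, fun v hv i ↦ ?_⟩
  have h := abs_le.1 ((PiLp.norm_apply_le v i).trans (hR v hv))
  fin_cases i <;> simp at h ⊢ <;> constructor <;> linarith

end ConeCurve

theorem mainTheorem3 (γ : unitInterval → ConeCurve.Plane) (hγ : Continuous γ)
    (k : ℕ) (φ ρ : ℝ) (hφ₀ : 0 < φ) (hφ₁ : φ < Real.pi / 2)
    (hk : ConeCurve.ConeLinesMeetAtMost (range γ) k φ ρ) :
    ∃ θ σ h : ℕ → ℚ,
      range (fun n => (θ n, σ n, h n)) =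
          {t : ℚ × ℚ × ℚ | ConeCurve.IsAdmissible φ ρ t.1 t.2.1 t.2.2} ∧
      range γ = ⋃ n, ConeCurve.freePoints (range γ) (θ n) (σ n) (h n) ∧
      (∀ n, μH[1] (ConeCurve.freePoints (range γ) (θ n) (σ n) (h n)) < ∞) ∧
      ∀ (a : ConeCurve.Plane) (L : ℝ),
        (∀ t i, a i ≤ γ t i ∧ γ t i ≤ a i + L) →
        ∀ n, μH[1] (ConeCurve.freePoints (range γ) (θ n) (σ n) (h n)) ≤
          ENNReal.ofReal (2 * k * L / Real.cos (θ n)) := by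
  have hK : IsCompact (range γ) := isCompact_range hγ
  have hcover := fun P (hP : P ∈ range γ) ↦
    ConeCurve.exists_rat_mem_freePoints hγ hφ₀ hφ₁ hk hP
  obtain ⟨f, hf⟩ := (to_countable
    {t : ℚ × ℚ × ℚ | ConeCurve.IsAdmissible φ ρ t.1 t.2.1 t.2.2}).exists_eq_range (by
      obtain ⟨θ, σ, h, hadm, -⟩ := hcover (γ 0) (mem_range_self 0)
      exact ⟨(θ, σ, h), hadm⟩)
  have hadm : ∀ n, ConeCurve.IsAdmissible φ ρ (f n).1 (f n).2.1 (f n).2.2 := fun n ↦ by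
    have : f n ∈ range f := mem_range_self n
    rwa [← hf] at this
  refine ⟨fun n ↦ (f n).1, fun n ↦ (f n).2.1, fun n ↦ (f n).2.2, hf.symm, ?_, ?_, ?_⟩
  · refine Subset.antisymm (fun P hP ↦ ?_) (iUnion_subset fun n P hP ↦ hP.1)
    obtain ⟨θ, σ, h, hadm', hfree⟩ := hcover P hP
    have : (θ, σ, h) ∈ range f := hf ▸ hadm'
    obtain ⟨n, hn⟩ := this
    refine mem_iUnion.2 ⟨n, ?_⟩
    simp only [hn]
    exact hfree
  · intro n
    obtain ⟨a, L, hsq⟩ := ConeCurve.exists_square_of_isCompact hK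
    exact (ConeCurve.hausdorffMeasure_freePoints_le hK hk (hadm n) hsq).trans_lt
      ENNReal.ofReal_lt_top
  · intro a L hsq n
    exact ConeCurve.hausdorffMeasure_freePoints_le hK hk (hadm n) (forall_mem_range.2 hsq)
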